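/- Let $G$ be a simply connected affine algebraic group over $\mathbb{C}$ whose Lie algebra $\mathfrak{g}$ is simple. Fix a Cartan subalgebra of $\mathfrak g$ and a base of the root system, let $I$ index the simple roots, and for $i\in I$ let $\rho_i\colon G\to \mathrm{GL}(V_{\omega_i})$ be the fundamental representation, i.e. the irreducible representation with highest weight the fundamental weight $\omega_i$. Let $G((z^{-1}))$ be the loop group, i.e. the ind-scheme $R\mapsto G(R((z^{-1})))$ on commutative $\mathbb{C}$-algebras $R$, and let $\mathcal{O}(G((z^{-1})))$ be its algebra of functions (morphisms from this functor to the affine line). For a regular function $a\in\mathcal{O}(G)$ and $r\in\mathbb{Z}$ let $a^{(r)}\in\mathcal{O}(G((z^{-1})))$ be the function whose value at $g$ is the coefficient of $z^{-r}$ in $a(g)$; the $a^{(r)}$, $r\in\mathbb Z$, are called the Fourier coefficients of $a$. Let $(\,,\,)$ be a nondegenerate invariant bilinear form on $\mathfrak{g}$, with dual bases $\{x_a\}$, $\{x^a\}$. For $x\in\mathfrak g$, $k\in\mathbb Z$ let $L_{xz^k}$ and $R_{xz^k}$ be the derivations of $\mathcal{O}(G((z^{-1})))$ given, with $\varepsilon^2=0$,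 by $f(g\cdot\exp(\varepsilon xz^k))=f(g)+\varepsilon\,(L_{xz^k}f)(g)$ and $f(\exp(\varepsilon xz^k)\cdot g)=f(g)+\varepsilon\,(R_{xz^k}f)(g)$. Equip $\mathcal{O}(G((z^{-1})))$ with the Poisson bracket of the Poisson–Lie structure of the Manin triple $(\mathfrak{g}((z^{-1})),\mathfrak{g}[z],z^{-1}\mathfrak{g}[[z^{-1}]])$, namely $$\{f,h\}=\sum_{k\ge 0}\sum_a\Big(R_{x_az^k}f\cdot R_{x^az^{-k-1}}h-L_{x_az^k}f\cdot L_{x^az^{-k-1}}h\Big),$$ where at each point only finitely many terms are nonzero. (On matrix entries $\Delta_{\beta,v}(g)=\langle\beta,gv\rangle$ of finite dimensional representations it satisfies $$\{\Delta^{(r+1)}_{\beta_1,v_1},\Delta^{(s)}_{\beta_2,v_2}\}-\{\Delta^{(r)}_{\beta_1,v_1},\Delta^{(s+1)}_{\beta_2,v_2}\}=\sum_a\Delta^{(r)}_{\beta_1,x_av_1}\Delta^{(s)}_{\beta_2,x^av_2}-\Delta^{(r)}_{x_a\beta_1,v_1}\Delta^{(s)}_{x^a\beta_2,v_2}.)$$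 For $C\in G(\mathbb C)$ let the classical universal Bethe subalgebra $\overline{\mathbf{B}}(C)\subset\mathcal{O}(G((z^{-1})))$ be the subalgebra generated by the Fourier coefficients of the functions $g\mapsto\mathrm{tr}_{V_{\omega_i}}\rho_i(C)\rho_i(g)$, $i\in I$. Then, for every $C\in G(\mathbb C)$, the subalgebra $\overline{\mathbf{B}}(C)$ is Poisson commutative: $\{f,h\}=0$ for all $f,h\in\overline{\mathbf{B}}(C)$. -/

import Mathlib

open scoped TensorProduct

noncomputable section

universe u v

namespace BetheLoop

/-! ## The algebraic group `G = Spec A`, its complex points and its Lie algebra -/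

/-- The group `G(ℂ)` of complex points of the affine group scheme `G = Spec A`. -/
def ComplexPoints (A : Type u) [CommRing A] [Algebra ℂ A] : Type u := A →ₐ[ℂ] ℂ

/-- The classical topology on `G(ℂ)`: the coarsest topology for which all regular functions
are continuous. (For `A` of finite type this is the subspace topology from any closed embedding
of `G` in an affine space.) -/
instance (A : Type u) [CommRing A] [Algebra ℂ A] : TopologicalSpace (ComplexPoints A) :=
  TopologicalSpace.induced (fun (C : A →ₐ[ℂ] ℂ) (a : A) => C a) inferInstance

section LieAlg

variable (A : Type u) [CommRing A] [HopfAlgebra ℂ A]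

/-- The Lie algebra of `G = Spec A`: the left invariant derivations of `A` (those with
`Δ ∘ D = (id ⊗ D) ∘ Δ`), with the commutator bracket. -/
def lieAlg : LieSubalgebra ℂ (Derivation ℂ A A) where
  carrier := {D | ∀ a : A, Coalgebra.comul (R := ℂ) (D a)
    = LinearMap.lTensor A (D : A →ₗ[ℂ] A) (Coalgebra.comul (R := ℂ) a)}
  zero_mem' := by
    intro a
    simp
  add_mem' := by
    intro D E hD hE a
    simp [hD a, hE a, LinearMap.lTensor_add]
  smul_mem' := by
    intro c D hD a
    simp [hD a, LinearMap.lTensor_smul]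
  lie_mem' := by
    intro D E hD hE a
    have h : ((⁅D, E⁆ : Derivation ℂ A A) : A →ₗ[ℂ] A)
        = (D : A →ₗ[ℂ] A) ∘ₗ (E : A →ₗ[ℂ] A) - (E : A →ₗ[ℂ] A) ∘ₗ (D : A →ₗ[ℂ] A) := by
      ext x
      exact Derivation.commutator_apply (D1 := D) (D2 := E) x
    have hD' : Coalgebra.comul (R := ℂ) ∘ₗ (D : A →ₗ[ℂ] A)
        = LinearMap.lTensor A (D : A →ₗ[ℂ] A) ∘ₗ Coalgebra.comul (R := ℂ) :=
      LinearMap.ext hD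
    have hE' : Coalgebra.comul (R := ℂ) ∘ₗ (E : A →ₗ[ℂ] A)
        = LinearMap.lTensor A (E : A →ₗ[ℂ] A) ∘ₗ Coalgebra.comul (R := ℂ) :=
      LinearMap.ext hE
    have h1 := LinearMap.congr_fun hD' (E a)
    have h2 := LinearMap.congr_fun hE' (D a)
    have h3 := LinearMap.congr_fun hE' a
    have h4 := LinearMap.congr_fun hD' a
    simp only [LinearMap.comp_apply, Derivation.coeFn_coe] at h1 h2 h3 h4
    rw [h, LinearMap.lTensor_sub, LinearMap.lTensor_comp, LinearMap.lTensor_comp,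
      Derivation.commutator_apply, map_sub, h1, h2, h3, h4]
    rfl

variable {A}

/-- The tangent vector at the identity, `a ↦ ε(D a)`, of a derivation `D`. -/
def tangent (D : Derivation ℂ A A) : A →ₗ[ℂ] ℂ :=
  (Coalgebra.counit (R := ℂ) (A := A)) ∘ₗ (D : A →ₗ[ℂ] A)

lemma tangent_mul (D : Derivation ℂ A A) (a b : A) : tangent D (a * b)
    = Coalgebra.counit (R := ℂ) a * tangent D b + Coalgebra.counit (R := ℂ) b * tangent D a := by
  simp [tangent, Derivation.leibniz]

lemma eq_of_tangent (D : lieAlg A) (a : A) : D.1 a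
    = TensorProduct.rid ℂ A (LinearMap.lTensor A (tangent D.1) (Coalgebra.comul (R := ℂ) a)) := by
  have h := D.2 a
  have h2 : LinearMap.lTensor A (tangent D.1) (Coalgebra.comul (R := ℂ) a)
      = LinearMap.lTensor A (Coalgebra.counit (R := ℂ) (A := A))
        (Coalgebra.comul (R := ℂ) (D.1 a)) := by
    rw [h, tangent, LinearMap.lTensor_comp]
    rfl
  rw [h2, Coalgebra.lTensor_counit_comul]
  simp

/-- The Lie algebra of an affine group scheme of finite type is finite dimensional. -/
instance [Algebra.FiniteType ℂ A] : Module.Finite ℂ (lieAlg A) := by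
  obtain ⟨s, hs⟩ := (inferInstance : Algebra.FiniteType ℂ A).out
  let F : lieAlg A →ₗ[ℂ] (s → ℂ) :=
    { toFun := fun D a => tangent D.1 a.1
      map_add' := by
        intro D E
        ext a
        simp [tangent]
      map_smul' := by
        intro c D
        ext a
        simp [tangent] }
  refine Module.Finite.of_injective F ?_
  rw [← LinearMap.ker_eq_bot, LinearMap.ker_eq_bot']
  intro D hD
  have key : ∀ a : A, tangent D.1 a = 0 := by
    intro a
    have ha : a ∈ Algebra.adjoin ℂ (s : Set A) := hs ▸ Algebra.mem_top
    induction ha using Algebra.adjoin_induction with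
    | mem x hx => exact congrFun hD ⟨x, hx⟩
    | algebraMap r => simp [tangent]
    | add x y _ _ hx hy => simp [hx, hy]
    | mul x y _ _ hx hy => simp [tangent_mul, hx, hy]
  have key' : tangent D.1 = 0 := LinearMap.ext key
  apply Subtype.ext
  ext a
  rw [eq_of_tangent D a, key']
  simp

/-- The linear map `a ↦ x(a₍₁₎) a₍₂₎` for a tangent vector `x = ε ∘ D` at the identity. -/
def rightInvariantLinear (D : Derivation ℂ A A) : A →ₗ[ℂ] A :=
  (TensorProduct.lid ℂ A).toLinearMap ∘ₗ LinearMap.rTensor A (tangent D)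
    ∘ₗ Coalgebra.comul (R := ℂ) (A := A)

lemma rightInvariant_aux (D : Derivation ℂ A A) (p q : A ⊗[ℂ] A) :
    TensorProduct.lid ℂ A (LinearMap.rTensor A (tangent D) (p * q))
      = TensorProduct.lid ℂ A (LinearMap.rTensor A (Coalgebra.counit (R := ℂ) (A := A)) p)
          * TensorProduct.lid ℂ A (LinearMap.rTensor A (tangent D) q)
        + TensorProduct.lid ℂ A (LinearMap.rTensor A (Coalgebra.counit (R := ℂ) (A := A)) q)
          * TensorProduct.lid ℂ A (LinearMap.rTensor A (tangent D) p) := by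
  induction p with
  | zero => simp
  | add p₁ p₂ h₁ h₂ =>
    simp only [add_mul, map_add, mul_add, h₁, h₂]
    ring
  | tmul a b =>
    induction q with
    | zero => simp
    | add q₁ q₂ h₁ h₂ =>
      simp only [add_mul, map_add, mul_add, h₁, h₂]
      ring
    | tmul c d =>
      simp only [Algebra.TensorProduct.tmul_mul_tmul, LinearMap.rTensor_tmul,
        TensorProduct.lid_tmul, tangent_mul, add_smul, mul_smul, smul_mul_smul_comm, mul_comm d b]

/-- The right invariant derivation `a ↦ x(a₍₁₎) a₍₂₎` of `A` that has the same tangent vector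
`x = ε ∘ D` at the identity as the derivation `D`. -/
def rightInvariant (D : Derivation ℂ A A) : Derivation ℂ A A :=
  Derivation.mk' (rightInvariantLinear D) (by
    intro a b
    simp only [rightInvariantLinear, LinearMap.comp_apply, Bialgebra.comul_mul,
      LinearEquiv.coe_coe, rightInvariant_aux, Coalgebra.rTensor_counit_comul,
      TensorProduct.lid_tmul, one_smul, smul_eq_mul])

end LieAlg

/-! ## The loop group `G((z⁻¹))` and the functions on it

The formal variable of `LaurentSeries R` is `t = z⁻¹`, so that the coefficient of `z^{-r}` is the
coefficient of index `r`, and `z^k` is `HahnSeries.single (-k) 1`. The loop group is the functor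
that sends a commutative `ℂ`-algebra `R` to `G(R((z⁻¹))) = (A →ₐ[ℂ] LaurentSeries R)`. -/

lemma algebraMap_laurent (R : Type u) [CommRing R] [Algebra ℂ R] (c : ℂ) :
    algebraMap ℂ (LaurentSeries R) c = HahnSeries.C (algebraMap ℂ R c) := by
  rw [HahnSeries.algebraMap_apply', PowerSeries.algebraMap_apply, HahnSeries.ofPowerSeries_C]

/-- Coefficientwise extension `R((z⁻¹)) → S((z⁻¹))` of an algebra map `R → S`. -/
def laurentMap {R : Type u} {S : Type v} [CommRing R] [Algebra ℂ R] [CommRing S] [Algebra ℂ S]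
    (φ : R →ₐ[ℂ] S) : LaurentSeries R →ₐ[ℂ] LaurentSeries S where
  toFun x := HahnSeries.map x φ
  map_one' := HahnSeries.map_one (RingHomClass.toRingHom φ).toMonoidWithZeroHom
  map_mul' x y := HahnSeries.map_mul (φ : R →ₙ+* S)
  map_zero' := HahnSeries.map_zero (φ : ZeroHom R S)
  map_add' x y := HahnSeries.map_add (φ : R →+ S)
  commutes' c := by
    rw [algebraMap_laurent, algebraMap_laurent]
    exact (HahnSeries.map_C _ (φ : R →+* S)).trans (by simp)

@[simp] lemma laurentMap_coeff {R : Type u} {S : Type v} [CommRing R] [Algebra ℂ R] [CommRing S]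
    [Algebra ℂ S] (φ : R →ₐ[ℂ] S) (x : LaurentSeries R) (n : ℤ) :
    (laurentMap φ x).coeff n = φ (x.coeff n) := rfl

/-- The algebra `O(G((z⁻¹)))` of functions on the ind-scheme `G((z⁻¹))`, i.e. of morphisms from
the functor `R ↦ G(R((z⁻¹)))` to the affine line: families of maps `G(R((z⁻¹))) → R` that are
natural in the commutative `ℂ`-algebra `R`, with pointwise operations. -/
def loopFunctions (A : Type u) [CommRing A] [Algebra ℂ A] :
    Subalgebra ℂ (∀ R : CommAlgCat.{u} ℂ, (A →ₐ[ℂ] LaurentSeries R) → R) where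
  carrier := {f | ∀ (R S : CommAlgCat.{u} ℂ) (φ : R →ₐ[ℂ] S) (γ : A →ₐ[ℂ] LaurentSeries R),
    f S ((laurentMap φ).comp γ) = φ (f R γ)}
  mul_mem' := by
    intro f g hf hg R S φ γ
    simp [hf R S φ γ, hg R S φ γ]
  add_mem' := by
    intro f g hf hg R S φ γ
    simp [hf R S φ γ, hg R S φ γ]
  algebraMap_mem' := by
    intro c R S φ γ
    simp [Pi.algebraMap_apply]


@[ext] lemma loopFunctions_ext {A : Type u} [CommRing A] [Algebra ℂ A] {f g : loopFunctions A}
    (h : ∀ (R : CommAlgCat.{u} ℂ) (γ : A →ₐ[ℂ] LaurentSeries R), f.1 R γ = g.1 R γ) : f = g :=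
  Subtype.ext (funext fun R => funext fun γ => h R γ)

section VectorFields

variable {A : Type u} [CommRing A] [Algebra ℂ A]

/-- The point `γ + ε z^k (γ ∘ D)` of the loop group over the dual numbers `R[ε]`: the tangent
vector at the `R`-point `γ` given by `z^k D`, for a derivation `D` of `A`, that is, a vector field
`D` on `G`. If `D` is left invariant with tangent vector `x` at the identity this is
`γ · exp(ε x z^k)`, and `exp(ε x z^k) · γ` if it is right invariant. -/
def deform {R : Type u} [CommRing R] [Algebra ℂ R] (D : Derivation ℂ A A) (k : ℤ)
    (γ : A →ₐ[ℂ] LaurentSeries R) : A →ₐ[ℂ] LaurentSeries (DualNumber R) where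
  toFun a := laurentMap (TrivSqZeroExt.inlAlgHom ℂ R R) (γ a)
    + HahnSeries.single (-k) DualNumber.eps * laurentMap (TrivSqZeroExt.inlAlgHom ℂ R R) (γ (D a))
  map_one' := by simp
  map_mul' a b := by
    have h : (HahnSeries.single (-k) DualNumber.eps : LaurentSeries (DualNumber R))
        * HahnSeries.single (-k) DualNumber.eps = 0 := by
      rw [HahnSeries.single_mul_single]
      simp
    simp only [Derivation.leibniz, map_mul, map_add, smul_eq_mul]
    linear_combination (-(laurentMap (TrivSqZeroExt.inlAlgHom ℂ R R) (γ (D a)))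
      * (laurentMap (TrivSqZeroExt.inlAlgHom ℂ R R) (γ (D b)))) * h
  map_zero' := by simp
  map_add' a b := by
    simp only [map_add]
    ring
  commutes' c := by
    rw [AlgHom.commutes, AlgHom.commutes, Derivation.map_algebraMap]
    simp

lemma deform_coeff {R : Type u} [CommRing R] [Algebra ℂ R] (D : Derivation ℂ A A) (k : ℤ)
    (γ : A →ₐ[ℂ] LaurentSeries R) (a : A) (n : ℤ) :
    (deform D k γ a).coeff n
      = TrivSqZeroExt.inl ((γ a).coeff n) + TrivSqZeroExt.inr ((γ (D a)).coeff (n + k)) := by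
  have h : (HahnSeries.single (-k) (DualNumber.eps : DualNumber R)
      * laurentMap (TrivSqZeroExt.inlAlgHom ℂ R R) (γ (D a))).coeff n
      = DualNumber.eps * TrivSqZeroExt.inl ((γ (D a)).coeff (n + k)) := by
    have := HahnSeries.coeff_single_mul_add (Γ := ℤ) (r := (DualNumber.eps : DualNumber R))
      (x := laurentMap (TrivSqZeroExt.inlAlgHom ℂ R R) (γ (D a))) (a := n + k) (b := -k)
    rw [show n + k + -k = n by ring] at this
    rw [this]
    rfl
  change (laurentMap (TrivSqZeroExt.inlAlgHom ℂ R R) (γ a)).coeff n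
    + (HahnSeries.single (-k) (DualNumber.eps : DualNumber R)
      * laurentMap (TrivSqZeroExt.inlAlgHom ℂ R R) (γ (D a))).coeff n = _
  rw [h]
  ext <;> simp

/-- The map `R[ε] → S[ε]` induced by an algebra map `R → S`. -/
def dualMap {R S : Type u} [CommRing R] [Algebra ℂ R] [CommRing S] [Algebra ℂ S]
    (φ : R →ₐ[ℂ] S) : DualNumber R →ₐ[ℂ] DualNumber S where
  toFun x := TrivSqZeroExt.inl (φ x.fst) + TrivSqZeroExt.inr (φ x.snd)
  map_one' := by ext <;> simp
  map_mul' x y := by ext <;> simp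
  map_zero' := by ext <;> simp
  map_add' x y := by ext <;> simp
  commutes' c := by ext <;> simp [TrivSqZeroExt.algebraMap_eq_inl']

lemma deform_natural {R S : Type u} [CommRing R] [Algebra ℂ R] [CommRing S] [Algebra ℂ S]
    (φ : R →ₐ[ℂ] S) (D : Derivation ℂ A A) (k : ℤ) (γ : A →ₐ[ℂ] LaurentSeries R) :
    deform D k ((laurentMap φ).comp γ) = (laurentMap (dualMap φ)).comp (deform D k γ) := by
  ext a n : 3
  rw [deform_coeff, AlgHom.comp_apply, AlgHom.comp_apply, AlgHom.comp_apply, laurentMap_coeff,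
    laurentMap_coeff, laurentMap_coeff, deform_coeff]
  simp [dualMap]

lemma deform_fst {R : Type u} [CommRing R] [Algebra ℂ R]
    (D : Derivation ℂ A A) (k : ℤ) (γ : A →ₐ[ℂ] LaurentSeries R) :
    (laurentMap (TrivSqZeroExt.fstHom ℂ R R)).comp (deform D k γ) = γ := by
  ext a n
  rw [AlgHom.comp_apply, laurentMap_coeff, deform_coeff]
  simp

lemma fst_deform (f : loopFunctions A) (R : CommAlgCat.{u} ℂ)
    (D : Derivation ℂ A A) (k : ℤ) (γ : A →ₐ[ℂ] LaurentSeries R) :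
    (f.1 (.of ℂ (DualNumber R)) (deform D k γ)).fst = f.1 R γ := by
  have := f.2 (.of ℂ (DualNumber R)) R (TrivSqZeroExt.fstHom ℂ R R) (deform D k γ)
  rw [deform_fst] at this
  exact this.symm

/-- The derivation of `O(G((z⁻¹)))` given by the vector field `z^k D` on the loop group:
`f(γ + ε z^k (γ ∘ D)) = f(γ) + ε (∂f)(γ)`. -/
def loopDerivation (D : Derivation ℂ A A) (k : ℤ) :
    Derivation ℂ (loopFunctions A) (loopFunctions A) :=
  Derivation.mk'
    { toFun := fun f =>
        ⟨fun R γ => (f.1 (.of ℂ (DualNumber R)) (deform D k γ)).snd, by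
          intro R S φ γ
          have := f.2 (.of ℂ (DualNumber R)) (.of ℂ (DualNumber S)) (dualMap φ) (deform D k γ)
          rw [← deform_natural] at this
          change TrivSqZeroExt.snd (f.1 (.of ℂ (DualNumber S)) _) = _
          rw [this]
          simp [dualMap]⟩
      map_add' := by
        intro f g
        ext R γ
        rfl
      map_smul' := by
        intro c f
        ext R γ
        rfl }
    (by
      intro f g
      ext R γ
      have hf := fst_deform f R D k γ
      have hg := fst_deform g R D k γ
      change TrivSqZeroExt.snd (f.1 (.of ℂ (DualNumber R)) (deform D k γ)
        * g.1 (.of ℂ (DualNumber R)) (deform D k γ) : DualNumber R) = 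
        f.1 R γ * TrivSqZeroExt.snd (g.1 (.of ℂ (DualNumber R)) (deform D k γ))
         + g.1 R γ * TrivSqZeroExt.snd (f.1 (.of ℂ (DualNumber R)) (deform D k γ))
      rw [DualNumber.snd_mul, hf, hg]
      ring)

/-- Sequences in `R[ε]` that are eventually constant with value in `R`. -/
def eventuallyConst (R : Type u) [CommRing R] [Algebra ℂ R] :
    Subalgebra ℂ (ℕ → DualNumber R) where
  carrier := {s | ∃ r : R, ∀ᶠ k in Filter.atTop, s k = TrivSqZeroExt.inl r}
  mul_mem' := by
    rintro s t ⟨r, hr⟩ ⟨q, hq⟩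
    refine ⟨r * q, ?_⟩
    filter_upwards [hr, hq] with k h1 h2
    simp [h1, h2]
  add_mem' := by
    rintro s t ⟨r, hr⟩ ⟨q, hq⟩
    refine ⟨r + q, ?_⟩
    filter_upwards [hr, hq] with k h1 h2
    simp [h1, h2]
  algebraMap_mem' c := ⟨algebraMap ℂ R c, by
    simp [TrivSqZeroExt.algebraMap_eq_inl']⟩

lemma deform_neg_eventually {R : Type u} [CommRing R] [Algebra ℂ R]
    (D : Derivation ℂ A A) (γ : A →ₐ[ℂ] LaurentSeries R) (a : A) (n : ℤ) :
    ∀ᶠ k : ℕ in Filter.atTop,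
      (deform D (-(k : ℤ) - 1) γ a).coeff n = TrivSqZeroExt.inl ((γ a).coeff n) := by
  filter_upwards [Filter.eventually_ge_atTop (n - (γ (D a)).order).toNat] with k hk
  rw [deform_coeff, HahnSeries.coeff_eq_zero_of_lt_order (x := γ (D a))]
  · simp
  · have := Int.self_le_toNat (n - (γ (D a)).order)
    omega

/-- All the deformations `deform D (-k-1) γ`, `k ∈ ℕ`, as one point of the loop group. -/
def deformFamily {R : Type u} [CommRing R] [Algebra ℂ R]
    (D : Derivation ℂ A A) (γ : A →ₐ[ℂ] LaurentSeries R) :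
    A →ₐ[ℂ] LaurentSeries (eventuallyConst R) := by
  let π : ∀ k : ℕ, eventuallyConst R →ₐ[ℂ] DualNumber R := fun k =>
    (Pi.evalAlgHom ℂ (fun _ : ℕ => DualNumber R) k).comp (eventuallyConst R).val
  have hπ : ∀ x y : LaurentSeries (eventuallyConst R),
      (∀ k, laurentMap (π k) x = laurentMap (π k) y) → x = y := by
    intro x y h
    ext n : 2
    apply Subtype.ext
    funext k
    exact congrArg (fun w : LaurentSeries (DualNumber R) => w.coeff n) (h k)
  let F : A → LaurentSeries (eventuallyConst R) := fun a =>
    HahnSeries.ofSuppBddBelow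
      (fun n => ⟨fun k => (deform D (-(k : ℤ) - 1) γ a).coeff n,
        ⟨(γ a).coeff n, deform_neg_eventually D γ a n⟩⟩) (by
      refine ⟨min (γ a).order (γ (D a)).order, ?_⟩
      intro n hn
      by_contra hlt
      apply hn
      apply Subtype.ext
      funext k
      change (deform D (-(k : ℤ) - 1) γ a).coeff n = 0
      rw [deform_coeff, HahnSeries.coeff_eq_zero_of_lt_order (x := γ a),
        HahnSeries.coeff_eq_zero_of_lt_order (x := γ (D a))]
      · simp
      · omega
      · omega)
  have hF : ∀ k a, laurentMap (π k) (F a) = deform D (-(k : ℤ) - 1) γ a := fun k a => rfl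
  exact
    { toFun := F
      map_one' := hπ _ _ fun k => by rw [hF, map_one, map_one]
      map_mul' := fun a b => hπ _ _ fun k => by rw [hF, map_mul, map_mul, hF, hF]
      map_zero' := hπ _ _ fun k => by rw [hF, map_zero, map_zero]
      map_add' := fun a b => hπ _ _ fun k => by rw [hF, map_add, map_add, hF, hF]
      commutes' := fun c => hπ _ _ fun k => by rw [hF, AlgHom.commutes, AlgHom.commutes] }

/-- At every point of the loop group, a function is annihilated by `z^{-k-1} D` for almost
all `k ∈ ℕ`. -/
lemma loopDerivation_neg_eventually (D : Derivation ℂ A A) (f : loopFunctions A)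
    (R : CommAlgCat.{u} ℂ) (γ : A →ₐ[ℂ] LaurentSeries R) :
    ∀ᶠ k : ℕ in Filter.atTop, (loopDerivation D (-(k : ℤ) - 1) f).1 R γ = 0 := by
  obtain ⟨r, hr⟩ := (f.1 (.of ℂ (eventuallyConst R)) (deformFamily D γ)).2
  filter_upwards [hr] with k hk
  have := f.2 (.of ℂ (eventuallyConst R)) (.of ℂ (DualNumber R))
    ((Pi.evalAlgHom ℂ (fun _ : ℕ => DualNumber R) k).comp (eventuallyConst R).val)
    (deformFamily D γ)
  have h2 : (laurentMap ((Pi.evalAlgHom ℂ (fun _ : ℕ => DualNumber R) k).comp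
      (eventuallyConst R).val)).comp (deformFamily D γ) = deform D (-(k : ℤ) - 1) γ := rfl
  rw [h2] at this
  change TrivSqZeroExt.snd (f.1 (.of ℂ (DualNumber R)) (deform D (-(k : ℤ) - 1) γ)) = 0
  rw [this]
  refine Eq.trans (congrArg TrivSqZeroExt.snd hk) ?_
  simp

/-- For a regular function `a` on `G` and `r : ℤ`, the function `a^{(r)}` on `G((z⁻¹))` whose value
at `g` is the coefficient of `z^{-r}` in the Laurent series `a(g)`. -/
def fourier (a : A) (r : ℤ) : loopFunctions A :=
  ⟨fun _ γ => (γ a).coeff r, fun _ _ _ _ => rfl⟩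

lemma loopDerivation_fourier (D : Derivation ℂ A A) (k : ℤ) (a : A) (r : ℤ) :
    loopDerivation D k (fourier a r) = fourier (D a) (r + k) := by
  ext R γ
  change TrivSqZeroExt.snd ((deform D k γ a).coeff r) = (γ (D a)).coeff (r + k)
  rw [deform_coeff]
  simp

end VectorFields

/-! ## The Poisson bracket -/

section Poisson

variable {A : Type u} [CommRing A] [HopfAlgebra ℂ A] {ι : Type v} [Fintype ι]

/-- The `k`-th term of the Poisson bracket: the bivector obtained from the right invariant vector
fields `x_a z^k`, `x^a z^{-k-1}`, minus the one obtained from the left invariant ones. -/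
def bracketTerm (x y : ι → lieAlg A) (f g : loopFunctions A) (k : ℕ) : loopFunctions A :=
  ∑ a, (loopDerivation (rightInvariant (x a).1) k f
          * loopDerivation (rightInvariant (y a).1) (-(k : ℤ) - 1) g
        - loopDerivation (x a).1 k f * loopDerivation (y a).1 (-(k : ℤ) - 1) g)

lemma bracketTerm_apply (x y : ι → lieAlg A) (f g : loopFunctions A) (k : ℕ)
    (R : CommAlgCat.{u} ℂ) (γ : A →ₐ[ℂ] LaurentSeries R) :
    (bracketTerm x y f g k).1 R γ =
      ∑ a, ((loopDerivation (rightInvariant (x a).1) k f).1 R γ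
          * (loopDerivation (rightInvariant (y a).1) (-(k : ℤ) - 1) g).1 R γ
        - (loopDerivation (x a).1 k f).1 R γ
          * (loopDerivation (y a).1 (-(k : ℤ) - 1) g).1 R γ) := by
  simp [bracketTerm, Finset.sum_apply]

lemma bracketTerm_eventually (x y : ι → lieAlg A) (f g : loopFunctions A)
    (R : CommAlgCat.{u} ℂ) (γ : A →ₐ[ℂ] LaurentSeries R) :
    ∀ᶠ k : ℕ in Filter.atTop, (bracketTerm x y f g k).1 R γ = 0 := by
  have h1 := Filter.eventually_all.2 fun a : ι =>
    loopDerivation_neg_eventually (rightInvariant (y a).1) g R γ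
  have h2 := Filter.eventually_all.2 fun a : ι =>
    loopDerivation_neg_eventually (y a).1 g R γ
  filter_upwards [h1, h2] with k hk1 hk2
  rw [bracketTerm_apply]
  simp [hk1, hk2]

/-- At each point of the loop group only finitely many terms of the bracket are nonzero. -/
lemma bracketTerm_finite (x y : ι → lieAlg A) (f g : loopFunctions A)
    (R : CommAlgCat.{u} ℂ) (γ : A →ₐ[ℂ] LaurentSeries R) :
    (Function.support fun k : ℕ => (bracketTerm x y f g k).1 R γ).Finite := by
  obtain ⟨K, hK⟩ := Filter.eventually_atTop.1 (bracketTerm_eventually x y f g R γ)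
  refine (Set.finite_lt_nat K).subset fun k hk => ?_
  by_contra hlt
  exact hk (hK k (not_lt.1 hlt))

/-- The Poisson bracket on `O(G((z⁻¹)))` of the Poisson-Lie structure defined by the Manin triple
`(𝔤((z⁻¹)), 𝔤[z], z⁻¹𝔤[[z⁻¹]])` with the residue pairing, where `x`, `y` are dual bases of `𝔤` for
the chosen invariant form. The canonical element of the triple is
`r = ∑_{k ≥ 0} ∑_a x_a z^k ⊗ x^a z^{-k-1}`, and the bracket is given by the difference of the right
and the left invariant bivector fields defined by `r`. The sum is finite at every point of the
loop group. `poissonBracket_fourier` below gives its values on the generators. -/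
def poissonBracket (x y : ι → lieAlg A) (f g : loopFunctions A) : loopFunctions A :=
  ⟨fun R γ => ∑ᶠ k : ℕ, (bracketTerm x y f g k).1 R γ, by
    intro R S φ γ
    have h := AddMonoidHom.map_finsum (φ : R →+ S) (bracketTerm_finite x y f g R γ)
    refine Eq.trans ?_ h.symm
    exact finsum_congr fun k => (bracketTerm x y f g k).2 R S φ γ⟩

/-- For regular functions `a`, `b` on `G`,
`{a^{(r+1)}, b^{(s)}} - {a^{(r)}, b^{(s+1)}}
  = ∑ (x_a ▹ a)^{(r)} (x^a ▹ b)^{(s)} - (a ◃ x_a)^{(r)} (b ◃ x^a)^{(s)}`,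
where `▹`, `◃` are the left and the right invariant vector fields. For matrix entries
`a(g) = ⟨β, g v⟩` one has `(x ▹ a)(g) = ⟨β, g x v⟩` and `(a ◃ x)(g) = ⟨β, x g v⟩ = -⟨x β, g v⟩`. -/
theorem poissonBracket_fourier (x y : ι → lieAlg A) (a b : A) (r s : ℤ) :
    poissonBracket x y (fourier a (r + 1)) (fourier b s)
      - poissonBracket x y (fourier a r) (fourier b (s + 1))
    = ∑ i, (fourier ((x i).1 a) r * fourier ((y i).1 b) s
        - fourier (rightInvariant (x i).1 a) r * fourier (rightInvariant (y i).1 b) s) := by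
  ext R γ
  let T : ℕ → R := fun k => (bracketTerm x y (fourier a r) (fourier b (s + 1)) k).1 R γ
  have hT : (Function.support T).Finite := bracketTerm_finite x y _ _ R γ
  have hshift : ∀ k : ℕ,
      (bracketTerm x y (fourier a (r + 1)) (fourier b s) k).1 R γ = T (k + 1) := by
    intro k
    have i1 : r + 1 + (k : ℤ) = r + ((k + 1 : ℕ) : ℤ) := by push_cast; ring
    have i2 : s + (-(k : ℤ) - 1) = s + 1 + (-((k + 1 : ℕ) : ℤ) - 1) := by push_cast; ring
    simp only [T, bracketTerm, loopDerivation_fourier]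
    rw [i1, i2]
  have h0 : T 0 = -(∑ i, (fourier ((x i).1 a) r * fourier ((y i).1 b) s
        - fourier (rightInvariant (x i).1 a) r
          * fourier (rightInvariant (y i).1 b) s) : loopFunctions A).1 R γ := by
    have i1 : r + ((0 : ℕ) : ℤ) = r := by simp
    have i2 : s + 1 + (-((0 : ℕ) : ℤ) - 1) = s := by simp
    simp only [T, bracketTerm, loopDerivation_fourier]
    rw [i1, i2, ← Pi.neg_apply, ← Pi.neg_apply, ← Subalgebra.coe_neg, ← Finset.sum_neg_distrib]
    simp only [neg_sub]
  obtain ⟨K, hK⟩ := Filter.eventually_atTop.1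
    (bracketTerm_eventually x y (fourier a r) (fourier b (s + 1)) R γ)
  have e1 : ∑ᶠ k, T k = ∑ k ∈ Finset.range (K + 1), T k :=
    finsum_eq_sum_of_support_subset _ (by
      intro k hk
      by_contra hc
      exact hk (hK k (by simp at hc; omega)))
  have e2 : ∑ᶠ k, T (k + 1) = ∑ k ∈ Finset.range K, T (k + 1) :=
    finsum_eq_sum_of_support_subset _ (by
      intro k hk
      by_contra hc
      exact hk (hK (k + 1) (by simp at hc; omega)))
  change (∑ᶠ k, (bracketTerm x y (fourier a (r + 1)) (fourier b s) k).1 R γ) - (∑ᶠ k, T k) = _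
  rw [finsum_congr hshift, e1, e2, Finset.sum_range_succ', h0]
  abel

/-- A subalgebra of `O(G((z⁻¹)))` is Poisson commutative if the bracket of any two of its elements
vanishes. -/
def IsPoissonCommutative (x y : ι → lieAlg A) (S : Subalgebra ℂ (loopFunctions A)) : Prop :=
  ∀ f ∈ S, ∀ g ∈ S, poissonBracket x y f g = 0

end Poisson

/-! ## Representations, fundamental representations and the Bethe subalgebra -/

/-- An algebraic representation of `G = Spec A` on `ℂⁿ`: the matrix `ρ = (ρ_{ij})` of its matrix
entries, which are regular functions on `G` with `ρ(gh) = ρ(g) ρ(h)` and `ρ(1) = 1`. -/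
structure MatrixRep (A : Type u) [CommRing A] [HopfAlgebra ℂ A] (n : ℕ) where
  /-- The matrix entries. -/
  entry : Matrix (Fin n) (Fin n) A
  comul_entry : ∀ i j, Coalgebra.comul (R := ℂ) (entry i j) = ∑ k, entry i k ⊗ₜ[ℂ] entry k j
  counit_entry : ∀ i j, Coalgebra.counit (R := ℂ) (entry i j) = if i = j then 1 else 0

namespace MatrixRep

variable {A : Type u} [CommRing A] [HopfAlgebra ℂ A] {n : ℕ}

/-- The operator `ρ(C)` for a point `C ∈ G(ℂ)`. -/
def atPoint (ρ : MatrixRep A n) (C : ComplexPoints A) : Matrix (Fin n) (Fin n) ℂ :=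
  Matrix.of fun i j => (show A →ₐ[ℂ] ℂ from C) (ρ.entry i j)

/-- The operator by which an element `D` of the Lie algebra acts: the differential of `ρ` at the
identity in the direction of `D`. -/
def differential (ρ : MatrixRep A n) (D : lieAlg A) : Matrix (Fin n) (Fin n) ℂ :=
  Matrix.of fun i j => tangent D.1 (ρ.entry i j)

/-- The representation of the Lie algebra is irreducible. -/
def IsIrreducible (ρ : MatrixRep A n) : Prop :=
  0 < n ∧ ∀ W : Submodule ℂ (Fin n → ℂ),
    (∀ D : lieAlg A, ∀ w ∈ W, (ρ.differential D).mulVec w ∈ W) → W = ⊥ ∨ W = ⊤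

/-- The regular function `g ↦ tr ρ(C) ρ(g)` on `G`. -/
def traceFunction (ρ : MatrixRep A n) (C : ComplexPoints A) : A :=
  Matrix.trace ((ρ.atPoint C).map (algebraMap ℂ A) * ρ.entry)

variable [Algebra.FiniteType ℂ A] [LieAlgebra.IsSimple ℂ (lieAlg A)]
  {𝔥 : LieSubalgebra ℂ (lieAlg A)} [𝔥.IsCartanSubalgebra]

/-- `ρ` is the fundamental representation `V_{ω_i}`: it is irreducible and has a highest weight
vector (a nonzero vector killed by the root spaces of all positive roots) whose weight is the
fundamental weight `ω_i`, i.e. takes the value `δ_{ij}` on the `j`-th simple coroot. -/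
def IsFundamental (b : (LieAlgebra.IsKilling.rootSystem 𝔥).Base) (i : b.support)
    (ρ : MatrixRep A n) : Prop :=
  ρ.IsIrreducible ∧ ∃ v : Fin n → ℂ, v ≠ 0 ∧
    (∀ α : 𝔥.root, b.IsPos α → ∀ e ∈ LieAlgebra.rootSpace 𝔥 α.1,
      (ρ.differential e).mulVec v = 0) ∧
    (ρ.differential ((LieAlgebra.IsKilling.rootSystem 𝔥).coroot i : 𝔥)).mulVec v = v ∧
    ∀ j : b.support, j ≠ i →
      (ρ.differential ((LieAlgebra.IsKilling.rootSystem 𝔥).coroot j : 𝔥)).mulVec v = 0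

end MatrixRep

/-- The classical universal Bethe subalgebra of `O(G((z⁻¹)))` of the point `C ∈ G(ℂ)`: the
subalgebra generated by the Fourier coefficients of `g ↦ tr ρ_i(C) ρ_i(g)`, where `ρ_i` runs over
the fundamental representations of `G`. -/
def betheSubalgebra {A : Type u} [CommRing A] [HopfAlgebra ℂ A] [Algebra.FiniteType ℂ A]
    [LieAlgebra.IsSimple ℂ (lieAlg A)] {𝔥 : LieSubalgebra ℂ (lieAlg A)} [𝔥.IsCartanSubalgebra]
    (b : (LieAlgebra.IsKilling.rootSystem 𝔥).Base) (C : ComplexPoints A) :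
    Subalgebra ℂ (loopFunctions A) :=
  Algebra.adjoin ℂ {σ | ∃ (i : b.support) (n : ℕ) (ρ : MatrixRep A n) (r : ℤ),
    ρ.IsFundamental b i ∧ σ = fourier (ρ.traceFunction C) r}

end BetheLoop

end

open BetheLoop

open scoped TensorProduct

namespace BetheLoop

/-! ## Invariant forms on simple Lie algebras -/

section InvariantForms

variable {L : Type*} [LieRing L] [LieAlgebra ℂ L] [Module.Finite ℂ L]

/-! Write `χ(g) = tr ρ(C) ρ(g)`. Moving `g` to `exp(εx) g` gives `tr ρ(C exp(εx) g)`, which by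
cyclicity is `tr ρ(g C exp(εx)) = tr ρ(C g exp(ε Ad(C)x))`. So on `χ` the right invariant field of
`x` equals the left invariant field of `Ad(C)x` (`rightInvariant_traceFunction`). As `C` does not
depend on `z`, the same holds with `x z^k` on Fourier coefficients.

The `k`-th term of the bracket of two generators is therefore `∑ F(Ad(C)x_a, Ad(C)x^a) - ∑ F(x_a,
x^a)` for one bilinear map `F`. It vanishes because the canonical element `∑ x_a ⊗ x^a` is fixed by
every isometry of the form (`sum_dualBases_isometry`). `Ad(C)` is an isometry: by Schur's argument
the form is a multiple of the Killing form, which all Lie algebra automorphisms preserve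
(`invariantForm_lieEquiv`).

Each term is a biderivation, so vanishing on generators extends to the whole subalgebra, separately
for every `k` (`isPoissonCommutative_adjoin`). -/

/-- Over `ℂ`, an invariant bilinear form on a simple Lie algebra is a multiple of the Killing
form. -/
theorem exists_eq_smul_killingForm [LieAlgebra.IsSimple ℂ L] (B : LinearMap.BilinForm ℂ L)
    (hB : ∀ x y z : L, B ⁅x, y⁆ z = B x ⁅y, z⁆) :
    ∃ c : ℂ, ∀ x y : L, B x y = c * killingForm ℂ L x y := by
  have hκ := LieAlgebra.IsKilling.killingForm_nondegenerate ℂ L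
  have : Nontrivial L := by
    by_contra h
    rw [not_nontrivial_iff_subsingleton] at h
    exact LieAlgebra.IsSimple.non_abelian ℂ (L := L) ⟨fun x y => Subsingleton.elim _ _⟩
  -- `φ` compares the two forms: `B u v = κ(φ u, v)`. Over `ℂ` it has an eigenvalue, as `L` is
  -- finite dimensional and nonzero.
  let φ : Module.End ℂ L :=
    ((LinearMap.BilinForm.toDual (killingForm ℂ L) hκ).symm : _ →ₗ[ℂ] L) ∘ₗ B
  have hφ : ∀ u v, killingForm ℂ L (φ u) v = B u v := fun u v =>
    LinearMap.BilinForm.apply_toDual_symm_apply (hB := hκ) (B u) v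
  obtain ⟨c, hc⟩ := Module.End.exists_eigenvalue φ
  obtain ⟨u, hu⟩ := hc.exists_hasEigenvector
  -- This is the `c`-eigenspace of `φ`, written through the two forms so that invariance of both
  -- shows directly that it is an ideal.
  let I : LieIdeal ℂ L :=
    { carrier := {w | ∀ v, B w v = c * killingForm ℂ L w v}
      zero_mem' := fun v => by simp
      add_mem' := fun {w w'} hw hw' v => by
        simp only [map_add, LinearMap.add_apply, hw v, hw' v, mul_add]
      smul_mem' := fun t w hw v => by
        simp only [map_smul, LinearMap.smul_apply, hw v, smul_eq_mul]
        ring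
      lie_mem := fun {z w} hw v => by
        rw [← lie_skew z w, map_neg, map_neg, LinearMap.neg_apply, LinearMap.neg_apply, hB,
          hw ⁅z, v⁆, LieModule.traceForm_apply_lie_apply]
        ring }
  have hI : I = ⊤ := by
    refine (LieAlgebra.IsSimple.eq_bot_or_eq_top I).resolve_left fun h => hu.2 ?_
    have hmem : u ∈ I := fun v => by
      rw [← hφ, hu.apply_eq_smul, map_smul, LinearMap.smul_apply, smul_eq_mul]
    simpa [h] using hmem
  refine ⟨c, fun x => ?_⟩
  have hx : x ∈ I := hI ▸ LieSubmodule.mem_top x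
  exact hx

/-- Over `ℂ`, an invariant bilinear form on a simple Lie algebra is invariant under all
automorphisms. -/
theorem invariantForm_lieEquiv [LieAlgebra.IsSimple ℂ L] (B : LinearMap.BilinForm ℂ L)
    (hB : ∀ x y z : L, B ⁅x, y⁆ z = B x ⁅y, z⁆) (e : L ≃ₗ⁅ℂ⁆ L) (u v : L) :
    B (e u) (e v) = B u v := by
  obtain ⟨c, hc⟩ := exists_eq_smul_killingForm B hB
  rw [hc, hc, LieAlgebra.killingForm_of_equiv_apply]

end InvariantForms

/-- The canonical element `∑ xᵢ ⊗ yᵢ` of a pair of dual bases for a bilinear form is invariant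
under the isometries of the form. -/
theorem sum_dualBases_isometry {K V W ι : Type*} [Field K] [AddCommGroup V] [Module K V]
    [AddCommGroup W] [Module K W] [Fintype ι] [DecidableEq ι] (B : LinearMap.BilinForm K V)
    (x y : Module.Basis ι K V) (dual : ∀ i j, B (x i) (y j) = if i = j then 1 else 0)
    (e : V ≃ₗ[K] V) (he : ∀ u v, B (e u) (e v) = B u v) (F : V →ₗ[K] V →ₗ[K] W) :
    ∑ i, F (e (x i)) (e (y i)) = ∑ i, F (x i) (y i) := by
  -- Coordinates in one basis are pairings with the other. Since `B` need not be symmetric, `x`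
  -- always stays in the first slot and `y` in the second.
  have hx : ∀ u, u = ∑ j, B u (y j) • x j := by
    intro u
    conv_lhs => rw [← x.sum_repr u]
    refine Finset.sum_congr rfl fun j _ => ?_
    congr 1
    conv_rhs => rw [← x.sum_repr u, map_sum, LinearMap.sum_apply]
    simp [dual]
  have hy : ∀ u, u = ∑ j, B (x j) u • y j := by
    intro u
    conv_lhs => rw [← y.sum_repr u]
    refine Finset.sum_congr rfl fun j _ => ?_
    congr 1
    conv_rhs => rw [← y.sum_repr u, map_sum]
    simp [dual]
  -- Expand `e (x i)` in the basis `x`, move `e` across the form as `e.symm`, and resum over `i` to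
  -- recover `e.symm (y j)`.
  calc ∑ i, F (e (x i)) (e (y i))
      = ∑ i, ∑ j, B (e (x i)) (y j) • F (x j) (e (y i)) := by
        refine Finset.sum_congr rfl fun i _ => ?_
        conv_lhs => rw [hx (e (x i))]
        simp
    _ = ∑ j, F (x j) (e (∑ i, B (x i) (e.symm (y j)) • y i)) := by
        rw [Finset.sum_comm]
        refine Finset.sum_congr rfl fun j _ => ?_
        rw [map_sum, map_sum]
        refine Finset.sum_congr rfl fun i _ => ?_
        rw [map_smul, map_smul, ← he (x i) (e.symm (y j)), e.apply_symm_apply]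
    _ = ∑ i, F (x i) (y i) := by
        refine Finset.sum_congr rfl fun j _ => ?_
        rw [← hy, e.apply_symm_apply]

/-! ## The adjoint action of a complex point -/

section Adjoint

variable {A : Type*} [CommRing A] [HopfAlgebra ℂ A]

/-- The linear map `a ↦ a₍₁₎ f(a₍₂₎)` for a linear form `f` on `A`. -/
def rightTranslate (f : A →ₗ[ℂ] ℂ) : A →ₗ[ℂ] A :=
  (TensorProduct.rid ℂ A).toLinearMap ∘ₗ LinearMap.lTensor A f
    ∘ₗ Coalgebra.comul (R := ℂ) (A := A)

/-- Coassociativity, in the guise that left and right translations commute. This is why conjugating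
by a right translation preserves left invariance. -/
lemma comul_rightTranslate (f : A →ₗ[ℂ] ℂ) (a : A) :
    Coalgebra.comul (R := ℂ) (rightTranslate f a)
      = LinearMap.lTensor A (rightTranslate f) (Coalgebra.comul (R := ℂ) a) := by
  have key : ∀ t : A ⊗[ℂ] A,
      Coalgebra.comul (R := ℂ) (TensorProduct.rid ℂ A (LinearMap.lTensor A f t))
        = LinearMap.lTensor A ((TensorProduct.rid ℂ A).toLinearMap ∘ₗ LinearMap.lTensor A f)
          (TensorProduct.assoc ℂ A A A
            (LinearMap.rTensor A (Coalgebra.comul (R := ℂ) (A := A)) t)) := by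
    intro t
    induction t with
    | zero => simp
    | add t₁ t₂ h₁ h₂ => simp only [map_add, h₁, h₂]
    | tmul p q =>
      simp only [LinearMap.lTensor_tmul, TensorProduct.rid_tmul, map_smul,
        LinearMap.rTensor_tmul]
      generalize Coalgebra.comul (R := ℂ) p = s
      induction s with
      | zero => simp
      | add s₁ s₂ h₁ h₂ => simp only [smul_add, TensorProduct.add_tmul, map_add, h₁, h₂]
      | tmul c d => simp
  change Coalgebra.comul (R := ℂ) (TensorProduct.rid ℂ A (LinearMap.lTensor A f
    (Coalgebra.comul (R := ℂ) a))) = _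
  rw [key, Coalgebra.coassoc_apply, ← LinearMap.lTensor_comp_apply]
  rfl

/-- The form `f ∘ₗ rightTranslate g` is the convolution of `f` and `g`, so identities between
translations reduce to identities between linear forms. -/
lemma rightTranslate_rightTranslate (f g : A →ₗ[ℂ] ℂ) (a : A) :
    rightTranslate f (rightTranslate g a) = rightTranslate (f ∘ₗ rightTranslate g) a := by
  change TensorProduct.rid ℂ A (LinearMap.lTensor A f
    (Coalgebra.comul (R := ℂ) (rightTranslate g a))) = _
  rw [comul_rightTranslate, ← LinearMap.lTensor_comp_apply]
  rfl

lemma rightTranslate_counit (a : A) :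
    rightTranslate (Coalgebra.counit (R := ℂ) (A := A)) a = a := by
  simp [rightTranslate]

/-- Translation by the inverse of a point is a right inverse of translation by the point. -/
lemma rightTranslate_antipode_right (C : A →ₐ[ℂ] ℂ) (a : A) :
    rightTranslate (C : A →ₗ[ℂ] ℂ)
      (rightTranslate ((C : A →ₗ[ℂ] ℂ) ∘ₗ HopfAlgebra.antipode ℂ) a) = a := by
  have h : (C : A →ₗ[ℂ] ℂ) ∘ₗ rightTranslate ((C : A →ₗ[ℂ] ℂ) ∘ₗ HopfAlgebra.antipode ℂ)
      = Coalgebra.counit (R := ℂ) (A := A) := by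
    ext b
    -- Multiplicativity of `C` turns the convolution of `C` with `C ∘ S` into `C` applied to the
    -- antipode axiom.
    have h1 : ∀ t : A ⊗[ℂ] A,
        C (TensorProduct.rid ℂ A (LinearMap.lTensor A
          ((C : A →ₗ[ℂ] ℂ) ∘ₗ HopfAlgebra.antipode ℂ) t))
        = C (LinearMap.mul' ℂ A (LinearMap.lTensor A (HopfAlgebra.antipode ℂ) t)) := by
      intro t
      induction t with
      | zero => simp
      | add t₁ t₂ h₁ h₂ => simp only [map_add, h₁, h₂]
      | tmul p q => simp [mul_comm]
    refine (h1 (Coalgebra.comul (R := ℂ) b)).trans ?_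
    rw [HopfAlgebra.mul_antipode_lTensor_comul_apply, AlgHom.commutes]
    rfl
  rw [rightTranslate_rightTranslate, h, rightTranslate_counit]

/-- Translation by the inverse of a point is a left inverse of translation by the point. -/
lemma rightTranslate_antipode_left (C : A →ₐ[ℂ] ℂ) (a : A) :
    rightTranslate ((C : A →ₗ[ℂ] ℂ) ∘ₗ HopfAlgebra.antipode ℂ)
      (rightTranslate (C : A →ₗ[ℂ] ℂ) a) = a := by
  have h : ((C : A →ₗ[ℂ] ℂ) ∘ₗ HopfAlgebra.antipode ℂ) ∘ₗ rightTranslate (C : A →ₗ[ℂ] ℂ)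
      = Coalgebra.counit (R := ℂ) (A := A) := by
    ext b
    have h1 : ∀ t : A ⊗[ℂ] A,
        C (HopfAlgebra.antipode ℂ (TensorProduct.rid ℂ A (LinearMap.lTensor A
          (C : A →ₗ[ℂ] ℂ) t)))
        = C (LinearMap.mul' ℂ A (LinearMap.rTensor A (HopfAlgebra.antipode ℂ) t)) := by
      intro t
      induction t with
      | zero => simp
      | add t₁ t₂ h₁ h₂ => simp only [map_add, h₁, h₂]
      | tmul p q => simp [mul_comm]
    refine (h1 (Coalgebra.comul (R := ℂ) b)).trans ?_
    rw [HopfAlgebra.mul_antipode_rTensor_comul_apply, AlgHom.commutes]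
    rfl
  rw [rightTranslate_rightTranslate, h, rightTranslate_counit]

/-- The automorphism `a ↦ a(· C)` of `A` for a point `C` of `G`. -/
def rightTranslateEquiv (C : A →ₐ[ℂ] ℂ) : A ≃ₐ[ℂ] A :=
  AlgEquiv.ofLinearEquiv
    (LinearEquiv.ofLinearMap (rightTranslate (C : A →ₗ[ℂ] ℂ))
      (rightTranslate ((C : A →ₗ[ℂ] ℂ) ∘ₗ HopfAlgebra.antipode ℂ))
      (LinearMap.ext (rightTranslate_antipode_right C))
      (LinearMap.ext (rightTranslate_antipode_left C)))
    (by
      change rightTranslate (C : A →ₗ[ℂ] ℂ) 1 = 1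
      simp [rightTranslate, Algebra.TensorProduct.one_def])
    (by
      intro a b
      -- `id ⊗ C` is multiplicative because `C` is, and so is the comultiplication.
      have key : ∀ s t : A ⊗[ℂ] A,
          TensorProduct.rid ℂ A (LinearMap.lTensor A (C : A →ₗ[ℂ] ℂ) (s * t))
            = TensorProduct.rid ℂ A (LinearMap.lTensor A (C : A →ₗ[ℂ] ℂ) s)
              * TensorProduct.rid ℂ A (LinearMap.lTensor A (C : A →ₗ[ℂ] ℂ) t) := by
        intro s t
        induction s with
        | zero => simp
        | add s₁ s₂ h₁ h₂ => simp only [add_mul, map_add, h₁, h₂]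
        | tmul p q =>
          induction t with
          | zero => simp
          | add t₁ t₂ h₁ h₂ => simp only [mul_add, map_add, h₁, h₂]
          | tmul c d =>
            simp [mul_smul, smul_comm (C q)]
      change rightTranslate (C : A →ₗ[ℂ] ℂ) (a * b)
        = rightTranslate (C : A →ₗ[ℂ] ℂ) a * rightTranslate (C : A →ₗ[ℂ] ℂ) b
      simp only [rightTranslate, LinearMap.comp_apply, Bialgebra.comul_mul,
        LinearEquiv.coe_coe, key])

lemma rightTranslateEquiv_apply (C : A →ₐ[ℂ] ℂ) (a : A) :
    rightTranslateEquiv C a = rightTranslate (C : A →ₗ[ℂ] ℂ) a := rfl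

/-- The derivation `σ ∘ D ∘ σ⁻¹`. -/
def conjDerivation (σ : A ≃ₐ[ℂ] A) (D : Derivation ℂ A A) : Derivation ℂ A A :=
  Derivation.mk' ((σ : A →ₗ[ℂ] A) ∘ₗ (D : A →ₗ[ℂ] A) ∘ₗ (σ.symm : A →ₗ[ℂ] A)) (by
    intro a b
    simp [Derivation.leibniz])

lemma conjDerivation_apply (σ : A ≃ₐ[ℂ] A) (D : Derivation ℂ A A) (a : A) :
    conjDerivation σ D a = σ (D (σ.symm a)) := rfl

/-- Conjugation of left invariant derivations by an automorphism of `A` that commutes with the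
left translations. -/
def conjLieHom (σ : A ≃ₐ[ℂ] A)
    (hσ : ∀ a : A, Coalgebra.comul (R := ℂ) (σ a)
      = LinearMap.lTensor A (σ : A →ₗ[ℂ] A) (Coalgebra.comul (R := ℂ) a))
    (hσ' : ∀ a : A, Coalgebra.comul (R := ℂ) (σ.symm a)
      = LinearMap.lTensor A (σ.symm : A →ₗ[ℂ] A) (Coalgebra.comul (R := ℂ) a)) :
    lieAlg A →ₗ⁅ℂ⁆ lieAlg A where
  toFun D := ⟨conjDerivation σ D.1, by
    intro a
    -- All three factors of `σ ∘ D ∘ σ⁻¹` act on the second tensor leg only, hence so does the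
    -- composite.
    rw [conjDerivation_apply, hσ, D.2, hσ', ← LinearMap.lTensor_comp_apply,
      ← LinearMap.lTensor_comp_apply]
    rfl⟩
  map_add' D E := by
    ext a
    simp [conjDerivation_apply]
  map_smul' c D := by
    ext a
    simp [conjDerivation_apply]
  map_lie' := by
    intro D E
    ext a
    simp [conjDerivation_apply, Derivation.commutator_apply]

/-- The adjoint action of a point `C` of `G` on the Lie algebra of `G`. -/
def adjoint (C : A →ₐ[ℂ] ℂ) : lieAlg A ≃ₗ⁅ℂ⁆ lieAlg A :=
  -- The inverse of the translation is by definition translation by `C ∘ S`, so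
  -- `comul_rightTranslate` serves for both directions.
  { conjLieHom (rightTranslateEquiv C) (comul_rightTranslate _) (comul_rightTranslate _) with
    invFun := conjLieHom (rightTranslateEquiv C).symm (comul_rightTranslate _)
      (comul_rightTranslate _)
    left_inv := by
      intro D
      ext a
      simp [conjLieHom, conjDerivation_apply]
    right_inv := by
      intro D
      ext a
      simp [conjLieHom, conjDerivation_apply] }

lemma adjoint_apply (C : A →ₐ[ℂ] ℂ) (D : lieAlg A) (a : A) :
    (adjoint C D).1 a = rightTranslateEquiv C (D.1 ((rightTranslateEquiv C).symm a)) := rfl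

end Adjoint

/-! ## Twisted characters -/

namespace MatrixRep

variable {A : Type*} [CommRing A] [HopfAlgebra ℂ A] {n : ℕ} (ρ : MatrixRep A n)

/-- A functional on the second leg of `Δρ = ρ ⊗ ρ` multiplies the matrix `ρ` by scalars on the
right. Left invariant fields do the same, while right invariant ones multiply on the left. -/
lemma rightTranslate_entry (f : A →ₗ[ℂ] ℂ) (i j : Fin n) :
    rightTranslate f (ρ.entry i j) = ∑ k, f (ρ.entry k j) • ρ.entry i k := by
  simp [rightTranslate, ρ.comul_entry]

lemma lieAlg_entry (D : lieAlg A) (i j : Fin n) :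
    D.1 (ρ.entry i j) = ∑ k, tangent D.1 (ρ.entry k j) • ρ.entry i k := by
  rw [eq_of_tangent D]
  simp [ρ.comul_entry]

lemma rightInvariant_entry (D : Derivation ℂ A A) (i j : Fin n) :
    rightInvariant D (ρ.entry i j) = ∑ k, tangent D (ρ.entry i k) • ρ.entry k j := by
  change rightInvariantLinear D (ρ.entry i j) = _
  simp [rightInvariantLinear, ρ.comul_entry]

lemma traceFunction_eq_sum (C : A →ₐ[ℂ] ℂ) :
    ρ.traceFunction C = ∑ i, ∑ j, C (ρ.entry i j) • ρ.entry j i := by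
  simp [traceFunction, atPoint, Matrix.trace, Matrix.mul_apply, Algebra.smul_def]

/-- By cyclicity the twisted character is the ordinary one translated by `C`; the inverse
translation inside `adjoint C` then cancels. -/
lemma traceFunction_eq_rightTranslate (C : A →ₐ[ℂ] ℂ) :
    ρ.traceFunction C = rightTranslateEquiv C (∑ i, ρ.entry i i) := by
  rw [traceFunction_eq_sum, map_sum, Finset.sum_comm]
  refine Finset.sum_congr rfl fun i _ => ?_
  rw [rightTranslateEquiv_apply, rightTranslate_entry]
  rfl

/-- On `g ↦ tr ρ(C) ρ(g)`, the right invariant vector field of a tangent vector `x` agrees with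
the left invariant vector field of `Ad(C) x`. -/
theorem rightInvariant_traceFunction (C : A →ₐ[ℂ] ℂ) (D : lieAlg A) :
    rightInvariant D.1 (ρ.traceFunction C) = (adjoint C D).1 (ρ.traceFunction C) := by
  have hl : rightInvariant D.1 (ρ.traceFunction C)
      = ∑ i, ∑ j, ∑ k, (C (ρ.entry i j) * tangent D.1 (ρ.entry j k)) • ρ.entry k i := by
    simp only [traceFunction_eq_sum, map_sum, Derivation.map_smul, rightInvariant_entry,
      Finset.smul_sum, smul_smul]
  have hr : (adjoint C D).1 (ρ.traceFunction C)
      = ∑ k, ∑ j, ∑ i, (C (ρ.entry i j) * tangent D.1 (ρ.entry j k)) • ρ.entry k i := by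
    rw [adjoint_apply, traceFunction_eq_rightTranslate, AlgEquiv.symm_apply_apply]
    simp only [map_sum, lieAlg_entry, map_smul, rightTranslateEquiv_apply,
      rightTranslate_entry, Finset.smul_sum, smul_smul]
    refine Finset.sum_congr rfl fun k _ => Finset.sum_congr rfl fun j _ =>
      Finset.sum_congr rfl fun i _ => ?_
    rw [mul_comm]
    rfl
  -- The two sides are `tr ρ(C) dρ(x) ρ(g)` and `tr ρ(g) ρ(C) dρ(x)`, so cyclicity amounts to
  -- reordering the three summations.
  rw [hl, hr, Finset.sum_comm]
  refine Eq.trans (Finset.sum_congr rfl fun j _ => Finset.sum_comm) Finset.sum_comm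

end MatrixRep

/-! ## Poisson commutativity -/

section Commutativity

variable {A : Type*} [CommRing A] [HopfAlgebra ℂ A] {ι : Type*} [Fintype ι]

/-- For fixed `k` the term is a finite sum of products of a derivation in each argument, hence a
biderivation. Arguing term by term avoids manipulating the pointwise finite sum over `k`. -/
lemma bracketTerm_add_left (x y : ι → lieAlg A) (f f' g : loopFunctions A) (k : ℕ) :
    bracketTerm x y (f + f') g k = bracketTerm x y f g k + bracketTerm x y f' g k := by
  simp only [bracketTerm, map_add, ← Finset.sum_add_distrib]
  exact Finset.sum_congr rfl fun i _ => by ring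

lemma bracketTerm_add_right (x y : ι → lieAlg A) (f g g' : loopFunctions A) (k : ℕ) :
    bracketTerm x y f (g + g') k = bracketTerm x y f g k + bracketTerm x y f g' k := by
  simp only [bracketTerm, map_add, ← Finset.sum_add_distrib]
  exact Finset.sum_congr rfl fun i _ => by ring

lemma bracketTerm_mul_left (x y : ι → lieAlg A) (f f' g : loopFunctions A) (k : ℕ) :
    bracketTerm x y (f * f') g k
      = f * bracketTerm x y f' g k + f' * bracketTerm x y f g k := by
  simp only [bracketTerm, Derivation.leibniz, smul_eq_mul, Finset.mul_sum,
    ← Finset.sum_add_distrib]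
  exact Finset.sum_congr rfl fun i _ => by ring

lemma bracketTerm_mul_right (x y : ι → lieAlg A) (f g g' : loopFunctions A) (k : ℕ) :
    bracketTerm x y f (g * g') k
      = g * bracketTerm x y f g' k + g' * bracketTerm x y f g k := by
  simp only [bracketTerm, Derivation.leibniz, smul_eq_mul, Finset.mul_sum,
    ← Finset.sum_add_distrib]
  exact Finset.sum_congr rfl fun i _ => by ring

lemma bracketTerm_algebraMap_left (x y : ι → lieAlg A) (c : ℂ) (g : loopFunctions A) (k : ℕ) :
    bracketTerm x y (algebraMap ℂ _ c) g k = 0 := by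
  simp [bracketTerm]

lemma bracketTerm_algebraMap_right (x y : ι → lieAlg A) (f : loopFunctions A) (c : ℂ) (k : ℕ) :
    bracketTerm x y f (algebraMap ℂ _ c) k = 0 := by
  simp [bracketTerm]

/-- A subalgebra is Poisson commutative if all terms of the bracket vanish on a set of
generators. -/
theorem isPoissonCommutative_adjoin (x y : ι → lieAlg A) (S : Set (loopFunctions A))
    (hS : ∀ f ∈ S, ∀ g ∈ S, ∀ k, bracketTerm x y f g k = 0) :
    IsPoissonCommutative x y (Algebra.adjoin ℂ S) := by
  intro f hf g hg
  -- Stronger than vanishing of the bracket, and stable under sums and products in both arguments.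
  have h : ∀ k, bracketTerm x y f g k = 0 := by
    intro k
    induction hf, hg using Algebra.adjoin_induction₂ with
    | mem_mem f g hf hg => exact hS f hf g hg k
    | algebraMap_both c d => exact bracketTerm_algebraMap_left x y c _ k
    | algebraMap_left c g _ => exact bracketTerm_algebraMap_left x y c g k
    | algebraMap_right c f _ => exact bracketTerm_algebraMap_right x y f c k
    | add_left f f' g _ _ _ h₁ h₂ => rw [bracketTerm_add_left, h₁, h₂, add_zero]
    | add_right f g g' _ _ _ h₁ h₂ => rw [bracketTerm_add_right, h₁, h₂, add_zero]
    | mul_left f f' g _ _ _ h₁ h₂ => rw [bracketTerm_mul_left, h₁, h₂, mul_zero, mul_zero, add_zero]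
    | mul_right f g g' _ _ _ h₁ h₂ =>
      rw [bracketTerm_mul_right, h₁, h₂, mul_zero, mul_zero, add_zero]
  ext R γ
  change ∑ᶠ k : ℕ, (bracketTerm x y f g k).1 R γ = 0
  simp [h]

/-- Complex scalars are constant Laurent series, so they do not shift coefficients. -/
lemma fourier_smul (c : ℂ) (a : A) (r : ℤ) : fourier (c • a) r = c • fourier a r := by
  ext R γ
  change (γ (c • a)).coeff r = c • (γ a).coeff r
  rw [Algebra.smul_def, map_mul, AlgHom.commutes, algebraMap_laurent, Algebra.smul_def,
    HahnSeries.C_mul_eq_smul, HahnSeries.coeff_smul, smul_eq_mul]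

/-- The bilinear map `(D, E) ↦ (D a)^{(r)} (E b)^{(s)}`. -/
noncomputable def fourierBilinear (a b : A) (r s : ℤ) :
    lieAlg A →ₗ[ℂ] lieAlg A →ₗ[ℂ] loopFunctions A :=
  LinearMap.mk₂ ℂ (fun D E => fourier (D.1 a) r * fourier (E.1 b) s)
    (fun D D' E => by
      ext R γ
      simp [fourier, add_mul])
    (fun c D E => by
      change fourier (c • D.1 a) r * _ = _
      rw [fourier_smul, smul_mul_assoc])
    (fun D E E' => by
      ext R γ
      simp [fourier, mul_add])
    (fun c D E => by
      change _ * fourier (c • E.1 b) s = _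
      rw [fourier_smul, mul_smul_comm])

/-- The terms of the bracket vanish on the Fourier coefficients of twisted characters if the
form is invariant under the adjoint action of the twisting point. -/
theorem bracketTerm_fourier_traceFunction [DecidableEq ι] (B : LinearMap.BilinForm ℂ (lieAlg A))
    (x y : Module.Basis ι ℂ (lieAlg A))
    (dual : ∀ i j, B (x i) (y j) = if i = j then 1 else 0) (C : A →ₐ[ℂ] ℂ)
    (hC : ∀ u v, B (adjoint C u) (adjoint C v) = B u v) {n m : ℕ} (ρ : MatrixRep A n)
    (τ : MatrixRep A m) (r s : ℤ) (k : ℕ) :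
    bracketTerm x y (fourier (ρ.traceFunction C) r) (fourier (τ.traceFunction C) s) k = 0 := by
  -- The index shifts `r + k` and `s - k - 1` come from `loopDerivation_fourier` and agree in both
  -- halves of the term, so a single bilinear map covers both.
  have h := sum_dualBases_isometry B x y dual (adjoint C).toLinearEquiv hC
    (fourierBilinear (ρ.traceFunction C) (τ.traceFunction C) (r + k) (s + (-(k : ℤ) - 1)))
  simp only [bracketTerm, loopDerivation_fourier, MatrixRep.rightInvariant_traceFunction,
    Finset.sum_sub_distrib]
  exact sub_eq_zero.2 h

end Commutativity

end BetheLoop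

open BetheLoop
theorem mainTheorem8 {A : Type*} [CommRing A] [HopfAlgebra ℂ A] [Algebra.FiniteType ℂ A]
    [SimplyConnectedSpace (ComplexPoints A)] [LieAlgebra.IsSimple ℂ (lieAlg A)]
    (𝔥 : LieSubalgebra ℂ (lieAlg A)) [𝔥.IsCartanSubalgebra]
    (b : (LieAlgebra.IsKilling.rootSystem 𝔥).Base)
    (form : LinearMap.BilinForm ℂ (lieAlg A)) (form_nondegenerate : form.Nondegenerate)
    (form_invariant : ∀ x y z : lieAlg A, form ⁅x, y⁆ z = form x ⁅y, z⁆)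
    {ι : Type} [Fintype ι] [DecidableEq ι] (x y : Module.Basis ι ℂ (lieAlg A))
    (dual : ∀ i j, form (x i) (y j) = if i = j then 1 else 0)
    (C : ComplexPoints A) :
    IsPoissonCommutative x y (betheSubalgebra b C) := by
  refine isPoissonCommutative_adjoin x y _ ?_
  -- The representations `ρ` and `τ` may differ, but both are twisted by the same `C`, so one
  -- automorphism acts on both tensor legs.
  rintro _ ⟨i, n, ρ, r, -, rfl⟩ _ ⟨j, m, τ, s, -, rfl⟩ k
  exact bracketTerm_fourier_traceFunction form x y dual C
    (invariantForm_lieEquiv form form_invariant (adjoint C)) ρ τ r s k
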